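/- Let $R$ be a commutative ring and let $(\mathcal C,\mathbb E,\mathfrak s)$ be an $R$-linear extriangulated category in the sense of Nakaoka and Palu. "Class" means class of objects of $\mathcal C$. For $i\ge 1$ let $\mathbb E^i$ be the higher extension functors, $\mathbb E^1=\mathbb E$ and $\mathbb E^{i+1}(-,A)=\mathbb E^{i}(-,A)\otimes_{\mathcal C}\mathbb E$. For a class $\mathcal X$ let ${}^{\perp}\mathcal X=\{M : \mathbb E^i(M,X)=0 \text{ for all } X\in\mathcal X,\ i\ge 1\}$. A class $\mathcal X$ is closed under extensions if $B\in\mathcal X$ for every $\mathbb E$-triangle $A\to B\to C\dashrightarrow$ with $A,C\in\mathcal X$. A class $\omega$ is a relative generator in $\mathcal X$ if $\omega\subseteq\mathcal X$ and every $X\in\mathcal X$ admits an $\mathbb E$-triangle $X'\to W\to X\dashrightarrow$ with $W\in\omega$ and $X'\in\mathcal X$. For a class $\mathcal Z$, a morphism $f:Z\to M$ is a $\mathcal Z$-precover if $Z\in\mathcal Z$ and $\mathrm{Hom}(Z',f)$ is surjective for all $Z'\in\mathcal Z$; a $\mathcal Z$-preenvelope is defined dually. For classes $\mathcal A,\mathcal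 B$, a finite $\mathcal B_{\mathcal A}$-coresolution of $M$ of length $n$ is a sequence $M\to B_0\to\cdots\to B_n$ obtained by splicing $\mathbb E$-triangles $N_{k-1}\to B_k\to N_k\dashrightarrow$ $(0\le k<n)$, with $N_{-1}=M$, $N_{n-1}\cong B_n$, $B_k\in\mathcal B$ and $N_k\in\mathcal A$ for $0\le k<n$, and $B_n\in\mathcal A\cap\mathcal B$ (for $n=0$: $M\cong B_0\in\mathcal A\cap\mathcal B$). Let $\mathcal B^{\vee}_{\mathcal A}$ be the class of objects having such a coresolution, $\mathcal B^\vee=\mathcal B^\vee_{\mathcal C}$, $(\mathcal A,\mathcal B)^\vee=\mathcal A\cap\mathcal B^\vee_{\mathcal A}$, and let $\mathrm{coresdim}^{\mathcal A}_{\mathcal B}(M)$ be the least length of such a coresolution ($\infty$ if there is none). **Theorem.** Let $\mathcal X\subseteq\mathcal Y$ be classes that are both closed under extensions, let $\omega$ be a relative generator in $\mathcal X$, and let $0\in\mathcal X$. (1) Let $Z\in\mathcal X^\vee_{\mathcal Y}$ and $n=\mathrm{coresdim}^{\mathcal Y}_{\mathcal X}(Z)$. There are $\mathbb E$-triangles $$Z\xrightarrow{g_Z}M_Z\to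 C_Z\dashrightarrow\quad\text{with } M_Z\in\mathcal X,\ C_Z\in(\mathcal Y,\omega)^\vee,$$ $$K_Z\to B_Z\xrightarrow{f_Z}Z\dashrightarrow\quad\text{with } K_Z\in\mathcal X,\ B_Z\in\omega^\vee_{\mathcal Y},$$ such that $\mathrm{coresdim}^{\mathcal Y}_{\omega}(B_Z)\le n$, and $\mathrm{coresdim}^{\mathcal Y}_{\omega}(C_Z)=n-1$ if $n\ge 1$, while $C_Z=0$ if $n=0$. (2) For every $\mathbb E$-triangle $K_Z\to B_Z\to Z\dashrightarrow$ with $K_Z\in\mathcal X$ and $B_Z\in\omega^\vee_{\mathcal Y}$ (in particular for the one in (1)): if $Z\in(\mathcal Y,\mathcal X)^\vee$, then $B_Z\in(\mathcal Y,\omega)^\vee$. (3) Suppose $\omega\subseteq{}^\perp\mathcal X$. Then $\omega^\vee\subseteq{}^\perp\mathcal X$. Moreover, for every $\mathbb E$-triangle $K_Z\to B_Z\xrightarrow{f_Z}Z\dashrightarrow$ with $K_Z\in\mathcal X$ and $B_Z\in\omega^\vee_{\mathcal Y}$, the morphism $f_Z$ is an $\omega^\vee$-precover, and for every $\mathbb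 E$-triangle $Z\xrightarrow{g_Z}M_Z\to C_Z\dashrightarrow$ with $M_Z\in\mathcal X$ and $C_Z\in(\mathcal Y,\omega)^\vee$, the morphism $g_Z$ is an $\mathcal X$-preenvelope (in particular, this holds for the triangles in (1)). -/

import Mathlib

open CategoryTheory CategoryTheory.Limits Opposite
open scoped TensorProduct

universe w v u r

namespace Extri

section Bifunctor

variable {R : Type r} [CommRing R] {C : Type u} [Category.{v} C]

/-- For a bifunctor `E`, the module `E(Z, A)` of `E`-extensions of `Z` by `A`
(contravariant in `Z`, covariant in `A`). -/
abbrev Extn (E : Cᵒᵖ ⥤ C ⥤ ModuleCat.{w} R) (Z A : C) : Type w :=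
  (E.obj (op Z)).obj A

/-- The map `a_* : E(Z, A) → E(Z, A')` induced by `a : A ⟶ A'`. -/
def push (E : Cᵒᵖ ⥤ C ⥤ ModuleCat.{w} R) (Z : C) {A A' : C} (a : A ⟶ A') :
    Extn E Z A →ₗ[R] Extn E Z A' :=
  ((E.obj (op Z)).map a).hom

/-- The map `c^* : E(Z, A) → E(Z', A)` induced by `c : Z' ⟶ Z`. -/
def pull (E : Cᵒᵖ ⥤ C ⥤ ModuleCat.{w} R) (A : C) {Z' Z : C} (c : Z' ⟶ Z) :
    Extn E Z A →ₗ[R] Extn E Z' A :=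
  ((E.map c.op).app A).hom

lemma push_pull (E : Cᵒᵖ ⥤ C ⥤ ModuleCat.{w} R) {A A' Z' Z : C} (a : A ⟶ A') (c : Z' ⟶ Z)
    (δ : Extn E Z A) : push E Z' a (pull E A c δ) = pull E A' c (push E Z a δ) :=
  (congrArg (fun f => f.hom δ) ((E.map c.op).naturality a)).symm

lemma pull_id (E : Cᵒᵖ ⥤ C ⥤ ModuleCat.{w} R) (A Z : C) : pull E A (𝟙 Z) = LinearMap.id := by
  simp [pull]

lemma pull_comp (E : Cᵒᵖ ⥤ C ⥤ ModuleCat.{w} R) (A : C) {Z'' Z' Z : C} (d : Z'' ⟶ Z')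
    (c : Z' ⟶ Z) : pull E A (d ≫ c) = pull E A d ∘ₗ pull E A c := by
  simp [pull]

/-- The direct sum `δ ⊕ δ' ∈ E(Z ⊕ Z', A ⊕ A')` of two extensions: its four components
are `δ`, `0`, `0`, `δ'`. -/
noncomputable def dirSum [Preadditive C] [HasBinaryBiproducts C]
    (E : Cᵒᵖ ⥤ C ⥤ ModuleCat.{w} R) {Z A Z' A' : C}
    (δ : Extn E Z A) (δ' : Extn E Z' A') : Extn E (Z ⊞ Z') (A ⊞ A') :=
  push E _ biprod.inl (pull E A biprod.fst δ) + push E _ biprod.inr (pull E A' biprod.snd δ')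

/-! ### Higher extensions

`E^1 = E` and `E^{k+1}(-, A) = E^k(-, A) ⊗_C E`, the tensor product of functors over `C`. -/

section Tensor

variable (E : Cᵒᵖ ⥤ C ⥤ ModuleCat.{w} R) (P : Cᵒᵖ ⥤ ModuleCat.{max u w} R)

/-- `⨁_M P(M) ⊗_R E(Z, M)`. -/
abbrev PreTensor (Z : C) : Type (max u w) :=
  DirectSum C fun M => (P.obj (op M) : Type (max u w)) ⊗[R] Extn E Z M

open Classical in
/-- The generator `x ⊗ δ` in the summand of index `M`. -/
noncomputable def preTmul (Z M : C) (x : P.obj (op M)) (δ : Extn E Z M) : PreTensor E P Z :=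
  DirectSum.lof R C (fun M => (P.obj (op M) : Type (max u w)) ⊗[R] Extn E Z M) M (x ⊗ₜ[R] δ)

/-- The relations `f^* x ⊗ δ = x ⊗ f_* δ` of the coend, for `f : M ⟶ N`. -/
def tensorRel (Z : C) : Submodule R (PreTensor E P Z) :=
  Submodule.span R {t | ∃ (M N : C) (f : M ⟶ N) (x : P.obj (op N)) (δ : Extn E Z M),
    t = preTmul E P Z M ((P.map f.op).hom x) δ - preTmul E P Z N x (push E Z f δ)}

open Classical in
/-- The map `⨁_M P(M) ⊗ E(Z, M) → ⨁_M P(M) ⊗ E(Z', M)` induced by `c : Z' ⟶ Z`. -/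
noncomputable def preTensorMap {Z' Z : C} (c : Z' ⟶ Z) :
    PreTensor E P Z →ₗ[R] PreTensor E P Z' :=
  DirectSum.toModule R C _ fun M =>
    DirectSum.lof R C (fun M => (P.obj (op M) : Type (max u w)) ⊗[R] Extn E Z' M) M ∘ₗ
      TensorProduct.map LinearMap.id (pull E M c)

lemma preTensorMap_preTmul {Z' Z : C} (c : Z' ⟶ Z) (M : C) (x : P.obj (op M))
    (δ : Extn E Z M) :
    preTensorMap E P c (preTmul E P Z M x δ) = preTmul E P Z' M x (pull E M c δ) := by
  classical
  simp [preTensorMap, preTmul, DirectSum.toModule_lof]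

lemma preTensor_hom_ext {Z : C} {V : Type*} [AddCommGroup V] [Module R V]
    {f g : PreTensor E P Z →ₗ[R] V}
    (h : ∀ M x δ, f (preTmul E P Z M x δ) = g (preTmul E P Z M x δ)) : f = g := by
  classical
  refine DirectSum.linearMap_ext R fun M => TensorProduct.ext' fun x δ => ?_
  exact h M x δ

lemma tensorRel_le_comap {Z' Z : C} (c : Z' ⟶ Z) :
    tensorRel E P Z ≤ (tensorRel E P Z').comap (preTensorMap E P c) := by
  refine Submodule.span_le.2 ?_
  rintro _ ⟨M, N, f, x, δ, rfl⟩
  refine Submodule.subset_span ⟨M, N, f, x, pull E M c δ, ?_⟩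
  rw [map_sub, preTensorMap_preTmul, preTensorMap_preTmul, push_pull]

/-- The functor `P ⊗_C E`, with value at `Z` the coend of `P(M) ⊗ E(Z, M)` over `M`. -/
noncomputable def tensorFunctor : Cᵒᵖ ⥤ ModuleCat.{max u w} R where
  obj Z := ModuleCat.of R (PreTensor E P Z.unop ⧸ tensorRel E P Z.unop)
  map c := ModuleCat.ofHom (Submodule.mapQ _ _ (preTensorMap E P c.unop)
    (tensorRel_le_comap E P c.unop))
  map_id Z := by
    ext1
    refine Submodule.linearMap_qext _ (preTensor_hom_ext E P fun M x δ => ?_)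
    simp [preTensorMap_preTmul, pull_id]
  map_comp c d := by
    ext1
    refine Submodule.linearMap_qext _ (preTensor_hom_ext E P fun M x δ => ?_)
    simp [preTensorMap_preTmul, pull_comp]

end Tensor

/-- `higherExt E A k` is the functor `E^{k+1}(-, A)`. -/
noncomputable def higherExt (E : Cᵒᵖ ⥤ C ⥤ ModuleCat.{w} R) (A : C) :
    ℕ → (Cᵒᵖ ⥤ ModuleCat.{max u w} R)
  | 0 => E.flip.obj A ⋙ ModuleCat.uliftFunctor.{u, w} R
  | k + 1 => tensorFunctor E (higherExt E A k)

end Bifunctor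

/-- An `R`-linear extriangulated structure `(C, E, s)` on an `R`-linear additive category `C`.
The realization `s` is encoded by the relation `Realizes δ x y`, which says that the sequence
`A --x--> B --y--> Z` belongs to the equivalence class `s(δ)`. -/
structure Extriangulated (R : Type r) [CommRing R] (C : Type u) [Category.{v} C]
    [Preadditive C] [Linear R C] [HasZeroObject C] [HasBinaryBiproducts C] where
  /-- the bifunctor of extensions -/
  E : Cᵒᵖ ⥤ C ⥤ ModuleCat.{w} R
  push_add : ∀ {Z A A' : C} (a b : A ⟶ A') (δ : Extn E Z A),
    push E Z (a + b) δ = push E Z a δ + push E Z b δ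
  push_smul : ∀ {Z A A' : C} (t : R) (a : A ⟶ A') (δ : Extn E Z A),
    push E Z (t • a) δ = t • push E Z a δ
  pull_add : ∀ {A Z' Z : C} (c d : Z' ⟶ Z) (δ : Extn E Z A),
    pull E A (c + d) δ = pull E A c δ + pull E A d δ
  pull_smul : ∀ {A Z' Z : C} (t : R) (c : Z' ⟶ Z) (δ : Extn E Z A),
    pull E A (t • c) δ = t • pull E A c δ
  /-- `A --x--> B --y--> Z` represents `s(δ)` -/
  Realizes : ∀ {A B Z : C}, Extn E Z A → (A ⟶ B) → (B ⟶ Z) → Prop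
  /-- `s(δ)` is one whole equivalence class of sequences -/
  exists_realizes : ∀ {A Z : C} (δ : Extn E Z A),
    ∃ (B : C) (x : A ⟶ B) (y : B ⟶ Z), Realizes δ x y
  realizes_iff : ∀ {A B B' Z : C} {δ : Extn E Z A} {x : A ⟶ B} {y : B ⟶ Z},
    Realizes δ x y → ∀ (x' : A ⟶ B') (y' : B' ⟶ Z),
      (Realizes δ x' y' ↔ ∃ b : B ≅ B', x ≫ b.hom = x' ∧ b.hom ≫ y' = y)
  /-- `s` is a realization: morphisms of extensions are realized -/
  exists_mid : ∀ {A B Z A' B' Z' : C} {δ : Extn E Z A} {x : A ⟶ B} {y : B ⟶ Z}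
    {δ' : Extn E Z' A'} {x' : A' ⟶ B'} {y' : B' ⟶ Z'},
    Realizes δ x y → Realizes δ' x' y' → ∀ (a : A ⟶ A') (c : Z ⟶ Z'),
      push E Z a δ = pull E A' c δ' →
      ∃ b : B ⟶ B', x ≫ b = a ≫ x' ∧ y ≫ c = b ≫ y'
  /-- `s` is additive -/
  realizes_zero : ∀ A Z : C,
    Realizes (0 : Extn E Z A) (biprod.inl : A ⟶ A ⊞ Z) (biprod.snd : A ⊞ Z ⟶ Z)
  realizes_dirSum : ∀ {A B Z A' B' Z' : C} {δ : Extn E Z A} {x : A ⟶ B} {y : B ⟶ Z}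
    {δ' : Extn E Z' A'} {x' : A' ⟶ B'} {y' : B' ⟶ Z'},
    Realizes δ x y → Realizes δ' x' y' →
      Realizes (dirSum E δ δ') (biprod.map x x') (biprod.map y y')
  /-- (ET3) -/
  exists_right : ∀ {A B Z A' B' Z' : C} {δ : Extn E Z A} {x : A ⟶ B} {y : B ⟶ Z}
    {δ' : Extn E Z' A'} {x' : A' ⟶ B'} {y' : B' ⟶ Z'},
    Realizes δ x y → Realizes δ' x' y' → ∀ (a : A ⟶ A') (b : B ⟶ B'),
      x ≫ b = a ≫ x' →
      ∃ c : Z ⟶ Z', push E Z a δ = pull E A' c δ' ∧ y ≫ c = b ≫ y'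
  /-- (ET3)ᵒᵖ -/
  exists_left : ∀ {A B Z A' B' Z' : C} {δ : Extn E Z A} {x : A ⟶ B} {y : B ⟶ Z}
    {δ' : Extn E Z' A'} {x' : A' ⟶ B'} {y' : B' ⟶ Z'},
    Realizes δ x y → Realizes δ' x' y' → ∀ (b : B ⟶ B') (c : Z ⟶ Z'),
      y ≫ c = b ≫ y' →
      ∃ a : A ⟶ A', push E Z a δ = pull E A' c δ' ∧ x ≫ b = a ≫ x'
  /-- (ET4) -/
  octahedron : ∀ {A B D G F : C} {δ : Extn E D A} {f : A ⟶ B} {f' : B ⟶ D}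
    {δ' : Extn E F B} {g : B ⟶ G} {g' : G ⟶ F},
    Realizes δ f f' → Realizes δ' g g' →
      ∃ (H : C) (h' : G ⟶ H) (d : D ⟶ H) (e : H ⟶ F) (δ'' : Extn E H A),
        Realizes δ'' (f ≫ g) h' ∧ f' ≫ d = g ≫ h' ∧ h' ≫ e = g' ∧
        Realizes (push E F f' δ') d e ∧
        pull E A d δ'' = δ ∧
        push E H f δ'' = pull E B e δ'
  /-- (ET4)ᵒᵖ -/
  octahedron_op : ∀ {D A B F G : C} {δ : Extn E B D} {f' : D ⟶ A} {f : A ⟶ B}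
    {δ' : Extn E G F} {g' : F ⟶ B} {g : B ⟶ G},
    Realizes δ f' f → Realizes δ' g' g →
      ∃ (H : C) (d : D ⟶ H) (e : H ⟶ F) (h' : H ⟶ A) (δ'' : Extn E G H),
        Realizes δ'' h' (f ≫ g) ∧ d ≫ h' = f' ∧ h' ≫ f = e ≫ g' ∧
        Realizes (pull E D g' δ) d e ∧
        push E G e δ'' = δ' ∧
        push E B d δ = pull E H g δ''

section Relative

variable {C : Type u} [Category.{v} C]

/-- `f : Z ⟶ M` is a `𝒵`-precover. -/
def IsPrecover (𝒵 : ObjectProperty C) {Z M : C} (f : Z ⟶ M) : Prop :=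
  𝒵 Z ∧ ∀ Z' : C, 𝒵 Z' → Function.Surjective fun g : Z' ⟶ Z => g ≫ f

/-- `f : M ⟶ Z` is a `𝒵`-preenvelope. -/
def IsPreenvelope (𝒵 : ObjectProperty C) {M Z : C} (f : M ⟶ Z) : Prop :=
  𝒵 Z ∧ ∀ Z' : C, 𝒵 Z' → Function.Surjective fun g : Z ⟶ Z' => f ≫ g

variable {R : Type r} [CommRing R] [Preadditive C] [Linear R C] [HasZeroObject C]
  [HasBinaryBiproducts C] (T : Extriangulated.{w} R C)

/-- `A --x--> B --y--> Z` is (the underlying sequence of) an `E`-triangle. -/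
def IsTriangle {A B Z : C} (x : A ⟶ B) (y : B ⟶ Z) : Prop :=
  ∃ δ : Extn T.E Z A, T.Realizes δ x y

/-- The class `𝒳` is closed under extensions. -/
def ClosedUnderExt (𝒳 : ObjectProperty C) : Prop :=
  ∀ ⦃A B Z : C⦄ (x : A ⟶ B) (y : B ⟶ Z), IsTriangle T x y → 𝒳 A → 𝒳 Z → 𝒳 B

/-- `ω` is a relative generator in `𝒳`. -/
def IsRelGenerator (ω 𝒳 : ObjectProperty C) : Prop :=
  ω ≤ 𝒳 ∧ ∀ X : C, 𝒳 X → ∃ (X' W : C) (x : X' ⟶ W) (y : W ⟶ X),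
    IsTriangle T x y ∧ 𝒳 X' ∧ ω W

/-- The left orthogonal class `⊥𝒳`: the objects `M` with `E^i(M, X) = 0` for all `X` in `𝒳`
and all `i ≥ 1`. -/
def leftOrth (𝒳 : ObjectProperty C) : ObjectProperty C := fun M =>
  ∀ X : C, 𝒳 X → ∀ k : ℕ, ∀ ξ : (higherExt T.E X k).obj (op M), ξ = 0

/-- `HasCores T 𝒳 𝒴 n M`: there is a finite `𝒴_𝒳`-coresolution `M → Y₀ → ⋯ → Yₙ` of length `n`,
that is, `E`-triangles `N_{k-1} → Y_k → N_k` for `0 ≤ k < n`, with `N_{-1} = M`, `N_{n-1} ≅ Yₙ`,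
`Y_k ∈ 𝒴` and `N_k ∈ 𝒳` for `0 ≤ k < n`, and `Yₙ ∈ 𝒳 ∩ 𝒴`. For `n = 0` this means `M ≅ Y₀`. -/
def HasCores (𝒳 𝒴 : ObjectProperty C) : ℕ → C → Prop
  | 0, M => (𝒳 ⊓ 𝒴).isoClosure M
  | n + 1, M => ∃ (Y N : C) (x : M ⟶ Y) (y : Y ⟶ N),
      IsTriangle T x y ∧ 𝒴 Y ∧ 𝒳 N ∧ HasCores 𝒳 𝒴 n N

/-- The `𝒴_𝒳`-coresolution dimension `coresdim^𝒳_𝒴(M)`, which is `⊤` if there is no finite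
`𝒴_𝒳`-coresolution. -/
noncomputable def coresdim (𝒳 𝒴 : ObjectProperty C) (M : C) : ℕ∞ :=
  sInf {m : ℕ∞ | ∃ k : ℕ, m = k ∧ HasCores T 𝒳 𝒴 k M}

/-- The class `𝒴^∨_𝒳` of the objects with a finite `𝒴_𝒳`-coresolution. The class `𝒴^∨`
is the case where `𝒳 = ⊤` consists of all objects. -/
def coresClass (𝒳 𝒴 : ObjectProperty C) : ObjectProperty C := fun M =>
  ∃ n : ℕ, HasCores T 𝒳 𝒴 n M

/-- The class `(𝒳, 𝒴)^∨ = 𝒳 ∩ 𝒴^∨_𝒳`. -/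
def pairClass (𝒳 𝒴 : ObjectProperty C) : ObjectProperty C :=
  𝒳 ⊓ coresClass T 𝒳 𝒴

end Relative

end Extri

/-! The `E`-triangles of (1) are built by induction on the length of the coresolution: a first step
`Z ⟶ X ⟶ N` and an approximation `K ⟶ B ⟶ N` have a fibre product `M`, which gives `Z ⟶ M ⟶ B` with
`M` in `𝒳`; choosing `K' ⟶ W ⟶ M` with `W` in `ω` and `K'` in `𝒳`, the cocone of `W ⟶ M ⟶ B`
given by (ET4)ᵒᵖ is the approximation of `Z`. The dimension of `C_Z` cannot be smaller, as
`Z ⟶ M_Z` prolongs a coresolution of `C_Z` to one of `Z`.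

For (3), `⊥𝒳` has to be closed under cocones, which follows from exactness of
`E^k(B, X) ⟶ E^k(A, X) ⟶ E^{k+1}(Z, X)` for an `E`-triangle `A ⟶ B ⟶ Z`. With `P = E^k(-, X)`, the
second map is `ξ ↦ ξ ⊗ δ`, and one must see that `ξ ⊗ δ = 0` in the coend only if `ξ` extends to
`B`. To detect this, let `Q(Z)` be the direct limit of the cokernels of `P(B) ⟶ P(A)` over all
`E`-triangles `A ⟶ B ⟶ Z` with third term `Z`: sending `ξ ⊗ δ` to the class of `ξ` is well defined,
and homotopy pushouts show that the cokernels embed into their limit. -/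

universe t

namespace Extri

section Functors

variable {R : Type r} [CommRing R] {C : Type u} [Category.{v} C]

section Presheaf

variable (P : Cᵒᵖ ⥤ ModuleCat.{t} R)

/-- The restriction map `P(N) → P(M)` of a presheaf of modules along `f : M ⟶ N`. -/
def res {M N : C} (f : M ⟶ N) : P.obj (op N) →ₗ[R] P.obj (op M) :=
  (P.map f.op).hom

lemma res_id {M : C} (ξ : P.obj (op M)) : res P (𝟙 M) ξ = ξ := by
  simp [res]

lemma res_comp {M N K : C} (f : M ⟶ N) (g : N ⟶ K) (ξ : P.obj (op K)) :
    res P (f ≫ g) ξ = res P f (res P g ξ) := by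
  simp [res]

end Presheaf

section Bifunctor

variable (E : Cᵒᵖ ⥤ C ⥤ ModuleCat.{w} R)

lemma push_id_apply {A Z : C} (δ : Extn E Z A) : push E Z (𝟙 A) δ = δ := by
  simp [push]

lemma push_comp_apply {A A' A'' Z : C} (a : A ⟶ A') (b : A' ⟶ A'') (δ : Extn E Z A) :
    push E Z (a ≫ b) δ = push E Z b (push E Z a δ) := by
  simp [push]

lemma pull_id_apply {A Z : C} (δ : Extn E Z A) : pull E A (𝟙 Z) δ = δ := by
  simp [pull]

lemma pull_comp_apply {A Z'' Z' Z : C} (d : Z'' ⟶ Z') (c : Z' ⟶ Z) (δ : Extn E Z A) :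
    pull E A (d ≫ c) δ = pull E A d (pull E A c δ) := by
  simp [pull]

end Bifunctor

section Tensor

variable {E : Cᵒᵖ ⥤ C ⥤ ModuleCat.{w} R} (P : Cᵒᵖ ⥤ ModuleCat.{max u w} R)

/-- The class of `ξ ⊗ δ` in `(P ⊗ E)(Z)`. -/
noncomputable def tmul {Z M : C} (ξ : P.obj (op M)) (δ : Extn E Z M) :
    (tensorFunctor E P).obj (op Z) :=
  Submodule.Quotient.mk (p := tensorRel E P Z) (preTmul E P Z M ξ δ)

variable {P}

lemma tmul_add {Z M : C} (ξ : P.obj (op M)) (δ ε : Extn E Z M) :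
    tmul P ξ (δ + ε) = tmul P ξ δ + tmul P ξ ε := by
  rw [tmul, preTmul, TensorProduct.tmul_add, map_add]
  rfl

lemma add_tmul {Z M : C} (ξ η : P.obj (op M)) (δ : Extn E Z M) :
    tmul P (ξ + η) δ = tmul P ξ δ + tmul P η δ := by
  rw [tmul, preTmul, TensorProduct.add_tmul, map_add]
  rfl

lemma tmul_smul {Z M : C} (c : R) (ξ : P.obj (op M)) (δ : Extn E Z M) :
    tmul P ξ (c • δ) = c • tmul P ξ δ := by
  rw [tmul, preTmul, TensorProduct.tmul_smul, map_smul]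
  rfl

lemma tmul_push {Z M N : C} (f : M ⟶ N) (ξ : P.obj (op N)) (δ : Extn E Z M) :
    tmul P ξ (push E Z f δ) = tmul P (res P f ξ) δ :=
  ((Submodule.Quotient.eq (tensorRel E P Z)).2
    (Submodule.subset_span ⟨M, N, f, ξ, δ, rfl⟩)).symm

lemma res_tmul {Z' Z M : C} (c : Z' ⟶ Z) (ξ : P.obj (op M)) (δ : Extn E Z M) :
    res (tensorFunctor E P) c (tmul P ξ δ) = tmul P ξ (pull E M c δ) :=
  congrArg (Submodule.Quotient.mk (p := tensorRel E P Z')) (preTensorMap_preTmul E P c M ξ δ)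

end Tensor

end Functors

variable {R : Type r} [CommRing R] {C : Type u} [Category.{v} C] [Preadditive C] [Linear R C]
  [HasZeroObject C] [HasBinaryBiproducts C] {T : Extriangulated.{w} R C}

namespace Extriangulated

lemma push_zero {Z A A' : C} (δ : Extn T.E Z A) : push T.E Z (0 : A ⟶ A') δ = 0 := by
  simpa using T.push_smul 0 (0 : A ⟶ A') δ

lemma push_sub {Z A A' : C} (a b : A ⟶ A') (δ : Extn T.E Z A) :
    push T.E Z (a - b) δ = push T.E Z a δ - push T.E Z b δ := by
  rw [eq_sub_iff_add_eq, ← T.push_add, sub_add_cancel]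

section ExtnLift

/-- The extension of `Z` by `M ⊞ N` with components `δ` and `ε`, under the identification
`E(Z, M ⊞ N) ≅ E(Z, M) × E(Z, N)`. -/
noncomputable def extnLift {Z M N : C} (δ : Extn T.E Z M) (ε : Extn T.E Z N) :
    Extn T.E Z (M ⊞ N) :=
  push T.E Z biprod.inl δ + push T.E Z biprod.inr ε

variable {Z M N : C} (δ : Extn T.E Z M) (ε : Extn T.E Z N)

lemma push_fst_extnLift : push T.E Z biprod.fst (extnLift δ ε) = δ := by
  simp only [extnLift, map_add, ← push_comp_apply, biprod.inl_fst, biprod.inr_fst, push_id_apply,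
    push_zero, add_zero]

lemma push_snd_extnLift : push T.E Z biprod.snd (extnLift δ ε) = ε := by
  simp only [extnLift, map_add, ← push_comp_apply, biprod.inl_snd, biprod.inr_snd, push_id_apply,
    push_zero, zero_add]

end ExtnLift

lemma realizes_zero_of_splitting {S : ShortComplex C} (s : S.Splitting) : T.Realizes 0 S.f S.g :=
  (T.realizes_iff (T.realizes_zero S.X₁ S.X₃) S.f S.g).2
    ⟨s.isoBinaryBiproduct.symm, by simp [ShortComplex.Splitting.isoBinaryBiproduct],
      by ext <;> simp [ShortComplex.Splitting.isoBinaryBiproduct]⟩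

lemma realizes_of_isZero_right {A B Z : C} (φ : A ≅ B) (hZ : IsZero Z) :
    T.Realizes 0 φ.hom (0 : B ⟶ Z) :=
  realizes_zero_of_splitting
    (.ofIsIsoOfIsZero (.mk φ.hom (0 : B ⟶ Z) comp_zero) (inferInstanceAs (IsIso φ.hom)) hZ)

lemma realizes_of_isZero_left {A B Z : C} (hA : IsZero A) (φ : B ≅ Z) :
    T.Realizes 0 (0 : A ⟶ B) φ.hom :=
  realizes_zero_of_splitting
    (.ofIsZeroOfIsIso (.mk (0 : A ⟶ B) φ.hom zero_comp) hA (inferInstanceAs (IsIso φ.hom)))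

namespace Realizes

variable {A B Z : C} {δ : Extn T.E Z A} {x : A ⟶ B} {y : B ⟶ Z}

lemma exists_iso {B' : C} {x' : A ⟶ B'} {y' : B' ⟶ Z} (h : T.Realizes δ x y)
    (h' : T.Realizes δ x' y') : ∃ b : B ≅ B', x ≫ b.hom = x' ∧ b.hom ≫ y' = y :=
  (T.realizes_iff h x' y').1 h'

/-! ### Long exact sequences -/

lemma exists_comp_eq_of_push_eq_zero (h : T.Realizes δ x y) {D : C} {f : A ⟶ D}
    (hf : push T.E Z f δ = 0) : ∃ g : B ⟶ D, x ≫ g = f := by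
  obtain ⟨b, hb, -⟩ := T.exists_mid h (T.realizes_zero D Z) f (𝟙 Z) (by rw [hf, map_zero])
  exact ⟨b ≫ biprod.fst, by rw [reassoc_of% hb, biprod.inl_fst, Category.comp_id]⟩

lemma exists_comp_eq_of_pull_eq_zero (h : T.Realizes δ x y) {D : C} {f : D ⟶ Z}
    (hf : pull T.E A f δ = 0) : ∃ g : D ⟶ B, g ≫ y = f := by
  obtain ⟨b, -, hb⟩ := T.exists_mid (T.realizes_zero A D) h (𝟙 A) f (by rw [hf, map_zero])
  exact ⟨biprod.inr ≫ b, by rw [Category.assoc, ← hb, biprod.inr_snd_assoc]⟩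

lemma exists_comp_eq_of_comp_eq_zero_right (h : T.Realizes δ x y) {D : C} {f : D ⟶ B}
    (hf : f ≫ y = 0) : ∃ g : D ⟶ A, g ≫ x = f := by
  obtain ⟨g, -, hg⟩ := T.exists_left
    (realizes_of_isZero_right (Iso.refl D) (isZero_zero C)) h f 0 (by rw [hf, zero_comp])
  exact ⟨g, by rw [← hg, Iso.refl_hom, Category.id_comp]⟩

lemma exists_comp_eq_of_comp_eq_zero_left (h : T.Realizes δ x y) {D : C} {f : B ⟶ D}
    (hf : x ≫ f = 0) : ∃ g : Z ⟶ D, y ≫ g = f := by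
  obtain ⟨g, -, hg⟩ := T.exists_right h
    (realizes_of_isZero_left (isZero_zero C) (Iso.refl D)) 0 f (by rw [hf, zero_comp])
  exact ⟨g, by rw [hg, Iso.refl_hom, Category.comp_id]⟩

lemma push_eq_zero (h : T.Realizes δ x y) : push T.E Z x δ = 0 := by
  obtain ⟨c, hc, -⟩ := T.exists_right h (T.realizes_zero B Z) x biprod.inl rfl
  rw [hc, map_zero]

lemma pull_eq_zero (h : T.Realizes δ x y) : pull T.E A y δ = 0 := by
  obtain ⟨c, hc, -⟩ := T.exists_left (T.realizes_zero A B) h biprod.snd y rfl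
  rw [← hc, map_zero]

lemma exists_push_eq_pull (h : T.Realizes δ x y) {D : C} (ε : Extn T.E B D) :
    ∃ (F : C) (d : D ⟶ F) (e : F ⟶ A) (ζ : Extn T.E Z F),
      T.Realizes (pull T.E D x ε) d e ∧ push T.E B d ε = pull T.E F y ζ := by
  obtain ⟨G, f', f, hf⟩ := T.exists_realizes ε
  obtain ⟨F, d, e, -, ζ, -, -, -, hde, -, hd⟩ := T.octahedron_op hf h
  exact ⟨F, d, e, ζ, hde, hd⟩

/-! ### Invariance under isomorphisms -/

section FiveLemma

variable {A' B' Z' : C} {δ' : Extn T.E Z' A'} {x' : A' ⟶ B'} {y' : B' ⟶ Z'} {a : A ≅ A'}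
  {b : B ⟶ B'} {c : Z ≅ Z'}

lemma pull_inv_eq_push_inv (hδ : push T.E Z a.hom δ = pull T.E A' c.hom δ') :
    pull T.E A c.inv δ = push T.E Z' a.inv δ' := by
  have h := congrArg (fun ε => push T.E Z' a.inv (pull T.E A' c.inv ε)) hδ
  rwa [← push_pull, ← push_comp_apply, a.hom_inv_id, push_id_apply, ← pull_comp_apply,
    c.inv_hom_id, pull_id_apply] at h

lemma isSplitEpi_mid (h : T.Realizes δ x y) (h' : T.Realizes δ' x' y')
    (hδ : push T.E Z a.hom δ = pull T.E A' c.hom δ') (hx : x ≫ b = a.hom ≫ x')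
    (hy : y ≫ c.hom = b ≫ y') : IsSplitEpi b := by
  obtain ⟨g, hg⟩ := h.exists_comp_eq_of_pull_eq_zero (f := y' ≫ c.inv) (by
    rw [pull_comp_apply, pull_inv_eq_push_inv hδ, ← push_pull, h'.pull_eq_zero, map_zero])
  obtain ⟨u, hu⟩ := h'.exists_comp_eq_of_comp_eq_zero_right (f := 𝟙 B' - g ≫ b) (by
    simp [← hy, reassoc_of% hg])
  refine .mk' ⟨g + u ≫ a.inv ≫ x, ?_⟩
  simp [hx, hu]

lemma isSplitMono_mid (h : T.Realizes δ x y) (h' : T.Realizes δ' x' y')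
    (hδ : push T.E Z a.hom δ = pull T.E A' c.hom δ') (hx : x ≫ b = a.hom ≫ x')
    (hy : y ≫ c.hom = b ≫ y') : IsSplitMono b := by
  obtain ⟨g, hg⟩ := h'.exists_comp_eq_of_push_eq_zero (f := a.inv ≫ x) (by
    rw [push_comp_apply, ← pull_inv_eq_push_inv hδ, push_pull, h.push_eq_zero, map_zero])
  obtain ⟨u, hu⟩ := h.exists_comp_eq_of_comp_eq_zero_left (f := 𝟙 B - b ≫ g) (by
    simp [reassoc_of% hx, hg])
  refine .mk' ⟨g + y' ≫ c.inv ≫ u, ?_⟩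
  simp [← reassoc_of% hy, hu]

lemma isIso_mid (h : T.Realizes δ x y) (h' : T.Realizes δ' x' y')
    (hδ : push T.E Z a.hom δ = pull T.E A' c.hom δ') (hx : x ≫ b = a.hom ≫ x')
    (hy : y ≫ c.hom = b ≫ y') : IsIso b :=
  have := isSplitEpi_mid h h' hδ hx hy
  have := isSplitMono_mid h h' hδ hx hy
  isIso_of_mono_of_isSplitEpi b

end FiveLemma

lemma comp_iso (h : T.Realizes δ x y) {Z' : C} (c : Z ≅ Z') :
    T.Realizes (pull T.E A c.inv δ) x (y ≫ c.hom) := by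
  obtain ⟨B', x', y', h'⟩ := T.exists_realizes (pull T.E A c.inv δ)
  have hδ : push T.E Z (Iso.refl A).hom δ = pull T.E A c.hom (pull T.E A c.inv δ) := by
    rw [Iso.refl_hom, push_id_apply, ← pull_comp_apply, c.hom_inv_id, pull_id_apply]
  obtain ⟨b, hx, hy⟩ := T.exists_mid h h' _ _ hδ
  have := isIso_mid h h' hδ hx hy
  rw [Iso.refl_hom, Category.id_comp] at hx
  exact (T.realizes_iff h' _ _).2 ⟨(asIso b).symm, by simp [← hx], by simp [hy]⟩

/-! ### Fibre products and homotopy pushouts -/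

/-- (ET4) with the third sequence given in advance. -/
lemma exists_octahedron {D G F H : C} {δ : Extn T.E D A} {f : A ⟶ B} {f' : B ⟶ D}
    {δ' : Extn T.E F B} {g : B ⟶ G} {g' : G ⟶ F} {d : D ⟶ H} {e : H ⟶ F}
    (hf : T.Realizes δ f f') (hg : T.Realizes δ' g g')
    (hd : T.Realizes (push T.E F f' δ') d e) :
    ∃ h : G ⟶ H, IsTriangle T (f ≫ g) h ∧ f' ≫ d = g ≫ h ∧ h ≫ e = g' := by
  obtain ⟨H', h, d', e', δ'', hδ'', hd', he', hd'', -, -⟩ := T.octahedron hf hg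
  obtain ⟨φ, rfl, rfl⟩ := hd''.exists_iso hd
  exact ⟨h ≫ φ.hom, ⟨_, hδ''.comp_iso φ⟩, by rw [reassoc_of% hd'], by rw [Category.assoc, he']⟩

lemma exists_fiberProduct {A₁ B₁ A₂ B₂ : C} {δ₁ : Extn T.E Z A₁} {x₁ : A₁ ⟶ B₁} {y₁ : B₁ ⟶ Z}
    {δ₂ : Extn T.E Z A₂} {x₂ : A₂ ⟶ B₂} {y₂ : B₂ ⟶ Z} (h₁ : T.Realizes δ₁ x₁ y₁)
    (h₂ : T.Realizes δ₂ x₂ y₂) :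
    ∃ (M : C) (i₁ : A₁ ⟶ M) (p₂ : M ⟶ B₂) (i₂ : A₂ ⟶ M) (p₁ : M ⟶ B₁),
      IsTriangle T i₁ p₂ ∧ IsTriangle T i₂ p₁ ∧ p₁ ≫ y₁ = p₂ ≫ y₂ := by
  obtain ⟨M, i, p, h⟩ := T.exists_realizes (extnLift δ₁ δ₂)
  have hinr : T.Realizes 0 (biprod.inr : A₂ ⟶ A₁ ⊞ A₂) biprod.fst :=
    realizes_zero_of_splitting (S := .mk _ _ biprod.inr_fst) ⟨biprod.snd, biprod.inl, by simp,
      by simp, by simp [add_comm, biprod.total]⟩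
  obtain ⟨p₁, hp₁, -, hpy₁⟩ :=
    exists_octahedron hinr h (by rwa [push_fst_extnLift δ₁ δ₂])
  obtain ⟨p₂, hp₂, -, hpy₂⟩ :=
    exists_octahedron (T.realizes_zero A₁ A₂) h (by rwa [push_snd_extnLift δ₁ δ₂])
  exact ⟨M, _, p₂, _, p₁, hp₂, hp₁, hpy₁.trans hpy₂.symm⟩

lemma biprodMap_id_left (h : T.Realizes δ x y) (M : C) :
    T.Realizes (push T.E Z biprod.inr δ) (biprod.map (𝟙 M) x) (biprod.snd ≫ y) := by
  obtain ⟨O, hO⟩ := HasZeroObject.zero (C := C)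
  let c : O ⊞ Z ≅ Z :=
    ⟨biprod.snd, biprod.inr, by ext <;> first | exact hO.eq_of_src _ _ | simp, by simp⟩
  convert (T.realizes_dirSum (realizes_of_isZero_right (Iso.refl M) hO) h).comp_iso c using 1
  · simp [dirSum, c, ← push_pull, ← pull_comp_apply, pull_id_apply]
  · simp
  · simp [c]

/-- By (ET4) for the composite `L ⟶ M ⊞ L ⟶ M ⊞ G`. -/
lemma exists_homotopyPushout {L M G W : C} {γ : Extn T.E Z L} {x : L ⟶ G} {y : G ⟶ Z} {h : L ⟶ M}
    {x' : M ⟶ W} {y' : W ⟶ Z} (hγ : T.Realizes γ x y) (hδ : T.Realizes (push T.E Z h γ) x' y') :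
    ∃ g : G ⟶ W, IsTriangle T (biprod.lift (-h) x) (biprod.desc x' g) := by
  have hsplit : T.Realizes 0 (biprod.lift (-h) (𝟙 L)) (biprod.desc (𝟙 M) h) :=
    realizes_zero_of_splitting (S := .mk (biprod.lift (-h) (𝟙 L)) (biprod.desc (𝟙 M) h) (by simp))
      ⟨biprod.snd, biprod.inl, by simp, by simp, by ext <;> simp⟩
  obtain ⟨q, hq, hxq, -⟩ := exists_octahedron hsplit (hγ.biprodMap_id_left M)
    (by rwa [← push_comp_apply, biprod.inr_desc])
  have hinl : biprod.inl ≫ q = x' := by simpa using (biprod.inl ≫= hxq).symm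
  refine ⟨biprod.inr ≫ q, ?_⟩
  convert hq using 1
  · ext <;> simp
  · ext <;> simp [hinl]

end Realizes

end Extriangulated

open Extriangulated

/-! ### Presheaves that are half exact on `E`-triangles -/

variable (T) in
/-- An `R`-linear presheaf of modules that sends `E`-triangles to sequences which are exact in the
middle, the analogue of a cohomological functor on a triangulated category. -/
structure IsCohomological (P : Cᵒᵖ ⥤ ModuleCat.{t} R) : Prop where
  res_add : ∀ {M N : C} (f g : M ⟶ N) (ξ : P.obj (op N)),
    res P (f + g) ξ = res P f ξ + res P g ξ
  res_smul : ∀ {M N : C} (c : R) (f : M ⟶ N) (ξ : P.obj (op N)),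
    res P (c • f) ξ = c • res P f ξ
  exact : ∀ {A B Z : C} {x : A ⟶ B} {y : B ⟶ Z}, IsTriangle T x y →
    ∀ ξ : P.obj (op B), res P x ξ = 0 → ∃ η : P.obj (op Z), res P y η = ξ

namespace IsCohomological

variable {P : Cᵒᵖ ⥤ ModuleCat.{t} R} (hP : IsCohomological T P)
include hP

lemma res_zero {M N : C} (ξ : P.obj (op N)) : res P (0 : M ⟶ N) ξ = 0 := by
  simpa using hP.res_smul 0 (0 : M ⟶ N) ξ

lemma res_neg {M N : C} (f : M ⟶ N) (ξ : P.obj (op N)) : res P (-f) ξ = -res P f ξ := by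
  simpa using hP.res_smul (-1) f ξ

lemma res_sub {M N : C} (f g : M ⟶ N) (ξ : P.obj (op N)) :
    res P (f - g) ξ = res P f ξ - res P g ξ := by
  rw [eq_sub_iff_add_eq, ← hP.res_add, sub_add_cancel]

/-- By exactness on the homotopy pushout triangle `L ⟶ M ⊞ G ⟶ W`. -/
lemma exists_res_eq_of_push {L G M W Z : C} {γ : Extn T.E Z L} {x : L ⟶ G} {y : G ⟶ Z} {h : L ⟶ M}
    {x' : M ⟶ W} {y' : W ⟶ Z} (hγ : T.Realizes γ x y) (hδ : T.Realizes (push T.E Z h γ) x' y')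
    {ξ : P.obj (op M)} {η : P.obj (op G)} (hη : res P x η = res P h ξ) :
    ∃ ζ : P.obj (op W), res P x' ζ = ξ := by
  obtain ⟨g, hg⟩ := hγ.exists_homotopyPushout hδ
  have hlift : res P (biprod.lift (-h) x) (res P biprod.fst ξ + res P biprod.snd η) = 0 := by
    rw [map_add, ← res_comp, ← res_comp, biprod.lift_fst, biprod.lift_snd, hP.res_neg, hη,
      neg_add_cancel]
  obtain ⟨ζ, hζ⟩ := hP.exact hg _ hlift
  refine ⟨ζ, ?_⟩
  rw [← biprod.inl_desc x' g, res_comp, hζ, map_add, ← res_comp, ← res_comp, biprod.inl_fst,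
    biprod.inl_snd, res_id, hP.res_zero, add_zero]

end IsCohomological

/-! ### The direct limit of the obstructions to extending an element -/

section Obstruction

variable (T) in
/-- An extension of `Z` by an arbitrary object; the index of the direct limit of obstructions. -/
structure ExtnOf (Z : C) where
  /-- the object by which `Z` is extended -/
  left : C
  /-- the extension -/
  ext : Extn T.E Z left

/-- An extension is above each of its pushforwards. -/
instance (Z : C) : Preorder (ExtnOf T Z) where
  le i j := ∃ h : j.left ⟶ i.left, push T.E Z h j.ext = i.ext
  le_refl i := ⟨𝟙 _, push_id_apply _ _⟩
  le_trans _ _ _ := fun ⟨h, hh⟩ ⟨h', hh'⟩ => ⟨h' ≫ h, by rw [push_comp_apply, hh', hh]⟩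

instance (Z : C) : IsDirectedOrder (ExtnOf T Z) where
  directed i j := ⟨⟨i.left ⊞ j.left, extnLift i.ext j.ext⟩,
    ⟨biprod.fst, push_fst_extnLift _ _⟩, ⟨biprod.snd, push_snd_extnLift _ _⟩⟩

variable (P : Cᵒᵖ ⥤ ModuleCat.{t} R)

/-- The elements of `P(A)` that extend to the middle term of a realization of `δ ∈ E(Z, A)`. The
realization is chosen, which is harmless by `mem_extendable`. -/
noncomputable def extendable {A Z : C} (δ : Extn T.E Z A) : Submodule R (P.obj (op A)) :=
  LinearMap.range (res P (T.exists_realizes δ).choose_spec.choose)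

lemma mem_extendable {A B Z : C} {δ : Extn T.E Z A} {x : A ⟶ B} {y : B ⟶ Z}
    (h : T.Realizes δ x y) {ξ : P.obj (op A)} : ξ ∈ extendable P δ ↔ ∃ η, res P x η = ξ := by
  obtain ⟨b, hb, -⟩ := (T.exists_realizes δ).choose_spec.choose_spec.choose_spec.exists_iso h
  constructor
  · rintro ⟨η, rfl⟩
    exact ⟨res P b.inv η, by rw [← res_comp, ← hb, Category.assoc, b.hom_inv_id, Category.comp_id]⟩
  · rintro ⟨η, rfl⟩
    exact ⟨res P b.hom η, by rw [← res_comp, hb]⟩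

lemma extendable_push_le_comap {L M Z : C} (h : L ⟶ M) (γ : Extn T.E Z L) :
    extendable P (push T.E Z h γ) ≤ (extendable P γ).comap (res P h) := by
  intro ξ hξ
  obtain ⟨G, x, y, hγ⟩ := T.exists_realizes γ
  obtain ⟨W, x', y', hδ⟩ := T.exists_realizes (push T.E Z h γ)
  obtain ⟨η, rfl⟩ := (mem_extendable P hδ).1 hξ
  obtain ⟨b, hb, -⟩ := T.exists_mid hγ hδ h (𝟙 Z) (by rw [pull_id_apply])
  exact (mem_extendable P hγ).2 ⟨res P b η, by rw [← res_comp, ← res_comp, hb]⟩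

/-- The quotient of `P(A)` by the elements that extend to the middle term. -/
abbrev Obstruction {Z : C} (i : ExtnOf T Z) : Type t :=
  P.obj (op i.left) ⧸ extendable P i.ext

/-- The transition maps between the modules of obstructions. They are induced by a chosen morphism,
but do not depend on it by `obstructionMap_mk`. -/
noncomputable def obstructionMap {Z : C} (i j : ExtnOf T Z) (hij : i ≤ j) :
    Obstruction P i →ₗ[R] Obstruction P j :=
  Submodule.mapQ _ _ (res P hij.choose) (by
    simpa only [hij.choose_spec] using extendable_push_le_comap P hij.choose j.ext)

open Classical in
variable (T) in
/-- The direct limit of the modules of obstructions over all extensions of `Z`. -/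
abbrev ObstructionLimit (Z : C) :=
  Module.DirectLimit (Obstruction P : ExtnOf T Z → _) (obstructionMap P)

open Classical in
/-- The class of `ξ ∈ P(M)` in the direct limit, as an obstruction at `δ ∈ E(Z, M)`. -/
noncomputable def obstruction {Z M : C} (δ : Extn T.E Z M) :
    P.obj (op M) →ₗ[R] ObstructionLimit T P Z :=
  Module.DirectLimit.of R _ (Obstruction P) (obstructionMap P) (⟨M, δ⟩ : ExtnOf T Z) ∘ₗ
    Submodule.mkQ _

namespace IsCohomological

variable {P} (hP : IsCohomological T P)
include hP

lemma obstructionMap_mk {Z : C} {i j : ExtnOf T Z} (hij : i ≤ j) (h : j.left ⟶ i.left)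
    (hh : push T.E Z h j.ext = i.ext) (ξ : P.obj (op i.left)) :
    obstructionMap P i j hij (Submodule.Quotient.mk ξ) = Submodule.Quotient.mk (res P h ξ) := by
  rw [obstructionMap, Submodule.mapQ_apply, Submodule.Quotient.eq, ← hP.res_sub]
  obtain ⟨G, x, y, hxy⟩ := T.exists_realizes j.ext
  obtain ⟨g, hg⟩ := hxy.exists_comp_eq_of_push_eq_zero (f := hij.choose - h)
    (by rw [push_sub, hij.choose_spec, hh, sub_self])
  exact (mem_extendable P hxy).2 ⟨res P g ξ, by rw [← res_comp, hg]⟩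

lemma directedSystem_obstruction (Z : C) :
    DirectedSystem (Obstruction P : ExtnOf T Z → _) (obstructionMap P · · ·) where
  map_self i ξ := by
    obtain ⟨ξ, rfl⟩ := Submodule.Quotient.mk_surjective _ ξ
    rw [hP.obstructionMap_mk _ (𝟙 _) (push_id_apply _ _), res_id]
  map_map k j i hij hjk ξ := by
    obtain ⟨ξ, rfl⟩ := Submodule.Quotient.mk_surjective _ ξ
    obtain ⟨h, hh⟩ := hij
    obtain ⟨h', hh'⟩ := hjk
    rw [hP.obstructionMap_mk _ h hh, hP.obstructionMap_mk _ h' hh',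
      hP.obstructionMap_mk _ (h' ≫ h) (by rw [push_comp_apply, hh', hh]), res_comp]

lemma obstruction_res {Z L M : C} (h : L ⟶ M) (γ : Extn T.E Z L) (ξ : P.obj (op M)) :
    obstruction P γ (res P h ξ) = obstruction P (push T.E Z h γ) ξ := by
  classical
  have hle : (⟨M, push T.E Z h γ⟩ : ExtnOf T Z) ≤ ⟨L, γ⟩ := ⟨h, rfl⟩
  have := Module.DirectLimit.of_f (R := R) (f := obstructionMap P) (hij := hle)
    (x := Submodule.Quotient.mk ξ)
  rwa [hP.obstructionMap_mk hle h rfl] at this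

lemma mem_extendable_of_obstruction_eq_zero {Z M : C} {δ : Extn T.E Z M} {ξ : P.obj (op M)}
    (hξ : obstruction P δ ξ = 0) : ξ ∈ extendable P δ := by
  classical
  have := hP.directedSystem_obstruction (T := T)
  obtain ⟨⟨L, γ⟩, hle, hγ⟩ := Module.DirectLimit.of.zero_exact hξ
  obtain ⟨h, rfl⟩ : ∃ h : L ⟶ M, push T.E Z h γ = δ := hle
  rw [Submodule.mkQ_apply, hP.obstructionMap_mk _ h rfl, Submodule.Quotient.mk_eq_zero] at hγ
  obtain ⟨G, x, y, hxy⟩ := T.exists_realizes γ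
  obtain ⟨W, x', y', hxy'⟩ := T.exists_realizes (push T.E Z h γ)
  obtain ⟨η, hη⟩ := (mem_extendable P hxy).1 hγ
  exact (mem_extendable P hxy').2 (hP.exists_res_eq_of_push hxy hxy' hη)

lemma obstruction_add {Z M : C} (δ ε : Extn T.E Z M) :
    obstruction P (δ + ε) = obstruction P δ + obstruction P ε := by
  ext ξ
  have h (f : M ⊞ M ⟶ M) := hP.obstruction_res f (extnLift δ ε) ξ
  have hsum : push T.E Z (biprod.fst + biprod.snd) (extnLift δ ε) = δ + ε := by
    rw [T.push_add, push_fst_extnLift, push_snd_extnLift]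
  rw [← hsum, ← h, hP.res_add, map_add, h, h, push_fst_extnLift, push_snd_extnLift,
    LinearMap.add_apply]

lemma obstruction_smul {Z M : C} (c : R) (δ : Extn T.E Z M) :
    obstruction P (c • δ) = c • obstruction P δ := by
  ext ξ
  have hc : push T.E Z (c • 𝟙 M) δ = c • δ := by rw [T.push_smul, push_id_apply]
  rw [← hc, ← hP.obstruction_res, hP.res_smul, res_id, map_smul, LinearMap.smul_apply]

end IsCohomological

end Obstruction

/-! ### Exactness of the connecting map and the higher extension functors -/

section Tensor

variable {P : Cᵒᵖ ⥤ ModuleCat.{max u w} R}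

/-- Every element of `(P ⊗ E)(Z)` is a pure tensor, since `ξ ⊗ δ + η ⊗ ε` is the tensor of an
element of `P(M ⊞ N)` with the extension of `Z` by `M ⊞ N` with components `δ` and `ε`. -/
lemma exists_tmul_eq {Z : C} (s : (tensorFunctor T.E P).obj (op Z)) :
    ∃ (M : C) (ξ : P.obj (op M)) (δ : Extn T.E Z M), tmul P ξ δ = s := by
  classical
  have hadd : ∀ s t : (tensorFunctor T.E P).obj (op Z),
      (∃ (M : C) (ξ : P.obj (op M)) (δ : Extn T.E Z M), tmul P ξ δ = s) →
      (∃ (M : C) (ξ : P.obj (op M)) (δ : Extn T.E Z M), tmul P ξ δ = t) →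
      ∃ (M : C) (ξ : P.obj (op M)) (δ : Extn T.E Z M), tmul P ξ δ = s + t := by
    rintro _ _ ⟨M, ξ, δ, rfl⟩ ⟨N, η, ε, rfl⟩
    refine ⟨M ⊞ N, res P biprod.fst ξ + res P biprod.snd η, extnLift δ ε, ?_⟩
    rw [add_tmul, ← tmul_push, ← tmul_push, push_fst_extnLift, push_snd_extnLift]
  have hzero : ∃ (M : C) (ξ : P.obj (op M)) (δ : Extn T.E Z M), tmul P ξ δ = 0 :=
    ⟨Z, 0, 0, by rw [← zero_smul R (0 : Extn T.E Z Z), tmul_smul, zero_smul]⟩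
  obtain ⟨s, rfl⟩ := Submodule.Quotient.mk_surjective _ s
  induction s using DirectSum.induction_on with
  | zero => exact hzero
  | of M s =>
    induction s using TensorProduct.induction_on with
    | zero => rw [map_zero]; exact hzero
    | tmul ξ δ => exact ⟨M, ξ, δ, rfl⟩
    | add s t hs ht => rw [map_add]; exact hadd _ _ hs ht
  | add s t hs ht => exact hadd _ _ hs ht

namespace IsCohomological

variable (hP : IsCohomological T P)

open Classical in
/-- The comparison map from the coend `(P ⊗ E)(Z)` to the direct limit of obstructions, sending
`ξ ⊗ δ` to the class of `ξ`. -/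
noncomputable def tensorToObstruction (Z : C) :
    (tensorFunctor T.E P).obj (op Z) →ₗ[R] ObstructionLimit T P Z :=
  (tensorRel T.E P Z).liftQ
    (DirectSum.toModule R C _ fun M => TensorProduct.lift (LinearMap.flip
      { toFun := fun δ : Extn T.E Z M => obstruction P δ
        map_add' := hP.obstruction_add
        map_smul' := hP.obstruction_smul })) (by
    refine Submodule.span_le.2 ?_
    rintro _ ⟨M, N, f, ξ, δ, rfl⟩
    rw [SetLike.mem_coe, LinearMap.mem_ker, map_sub, sub_eq_zero, preTmul, preTmul,
      DirectSum.toModule_lof, DirectSum.toModule_lof]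
    exact hP.obstruction_res f δ ξ)

lemma tensorToObstruction_tmul {Z M : C} (ξ : P.obj (op M)) (δ : Extn T.E Z M) :
    hP.tensorToObstruction Z (tmul P ξ δ) = obstruction P δ ξ := by
  classical
  exact (Submodule.liftQ_apply _ _ _).trans (by rw [preTmul, DirectSum.toModule_lof]; rfl)

include hP

lemma exists_res_eq_of_tmul_eq_zero {A B Z : C} {δ : Extn T.E Z A} {x : A ⟶ B} {y : B ⟶ Z}
    (h : T.Realizes δ x y) {ξ : P.obj (op A)} (hξ : tmul P ξ δ = 0) :
    ∃ η : P.obj (op B), res P x η = ξ := by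
  refine (mem_extendable P h).1 (hP.mem_extendable_of_obstruction_eq_zero ?_)
  rw [← hP.tensorToObstruction_tmul, hξ, map_zero]

lemma tensorFunctor : IsCohomological T (tensorFunctor T.E P) where
  res_add f g s := by
    obtain ⟨M, ξ, δ, rfl⟩ := exists_tmul_eq s
    rw [res_tmul, res_tmul, res_tmul, T.pull_add, tmul_add]
  res_smul c f s := by
    obtain ⟨M, ξ, δ, rfl⟩ := exists_tmul_eq s
    rw [res_tmul, res_tmul, T.pull_smul, tmul_smul]
  exact := by
    rintro A B Z x y ⟨δ, h⟩ s hs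
    obtain ⟨M, ξ, ε, rfl⟩ := exists_tmul_eq s
    rw [res_tmul] at hs
    obtain ⟨F, d, e, ζ, hde, hd⟩ := h.exists_push_eq_pull ε
    obtain ⟨η, rfl⟩ := hP.exists_res_eq_of_tmul_eq_zero hde hs
    exact ⟨tmul P η ζ, by rw [res_tmul, ← hd, tmul_push]⟩

end IsCohomological

lemma Extriangulated.Realizes.exists_pull_eq_of_pull_eq_zero {A B Z D : C} {δ : Extn T.E Z A}
    {x : A ⟶ B} {y : B ⟶ Z} (h : T.Realizes δ x y) {ε : Extn T.E B D}
    (hε : pull T.E D x ε = 0) : ∃ ζ : Extn T.E Z D, pull T.E D y ζ = ε := by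
  obtain ⟨F, d, e, ζ, hde, hd⟩ := h.exists_push_eq_pull ε
  rw [hε] at hde
  obtain ⟨p, hp⟩ := hde.exists_comp_eq_of_push_eq_zero (f := 𝟙 D) (map_zero _)
  exact ⟨push T.E Z p ζ, by rw [← push_pull, ← hd, ← push_comp_apply, hp, push_id_apply]⟩

variable (T) in
lemma isCohomological_higherExt (A : C) (k : ℕ) : IsCohomological T (higherExt T.E A k) := by
  induction k with
  | zero =>
    refine ⟨fun f g ξ => congrArg ULift.up (T.pull_add f g ξ.down),
      fun c f ξ => congrArg ULift.up (T.pull_smul c f ξ.down), ?_⟩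
    rintro A' B Z x y ⟨δ, h⟩ ξ hξ
    obtain ⟨ζ, hζ⟩ := h.exists_pull_eq_of_pull_eq_zero (congrArg ULift.down hξ)
    exact ⟨ULift.up ζ, congrArg ULift.up hζ⟩
  | succ k ih => exact ih.tensorFunctor

end Tensor

variable {𝒳 𝒴 ω : ObjectProperty C}

/-! ### The left orthogonal class -/

section LeftOrth

instance : (leftOrth T 𝒳).IsClosedUnderIsomorphisms where
  of_iso {A B} e hA X hX k ξ := by
    rw [← res_id _ ξ, ← e.inv_hom_id, res_comp, hA X hX k (res _ e.hom ξ), map_zero]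

lemma leftOrth_of_isTriangle {A B Z : C} {x : A ⟶ B} {y : B ⟶ Z} (h : IsTriangle T x y)
    (hB : leftOrth T 𝒳 B) (hZ : leftOrth T 𝒳 Z) : leftOrth T 𝒳 A := by
  intro X hX k ξ
  obtain ⟨δ, hδ⟩ := h
  obtain ⟨η, rfl⟩ := (isCohomological_higherExt T X k).exists_res_eq_of_tmul_eq_zero hδ
    (hZ X hX (k + 1) (tmul _ ξ δ))
  rw [hB X hX k η, map_zero]

lemma leftOrth_of_hasCores (hω : ω ≤ leftOrth T 𝒳) :
    ∀ {n : ℕ} {M : C}, HasCores T 𝒴 ω n M → leftOrth T 𝒳 M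
  | 0, M, hM => (ObjectProperty.isoClosure_le_iff _ _).2 (inf_le_right.trans hω) M hM
  | _ + 1, _, ⟨_, _, _, _, h, hY, _, hN⟩ =>
    leftOrth_of_isTriangle h (hω _ hY) (leftOrth_of_hasCores hω hN)

lemma coresClass_le_leftOrth (hω : ω ≤ leftOrth T 𝒳) : coresClass T 𝒴 ω ≤ leftOrth T 𝒳 :=
  fun _ ⟨_, hM⟩ => leftOrth_of_hasCores hω hM

lemma eq_zero_of_leftOrth {M X : C} (hM : leftOrth T 𝒳 M) (hX : 𝒳 X) (δ : Extn T.E M X) : δ = 0 :=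
  congrArg ULift.down (hM X hX 0 (ULift.up δ))

lemma IsTriangle.isPrecover {𝒵 : ObjectProperty C} (h𝒵 : 𝒵 ≤ leftOrth T 𝒳) {K B Z : C} {i : K ⟶ B}
    {f : B ⟶ Z} (h : IsTriangle T i f) (hK : 𝒳 K) (hB : 𝒵 B) : IsPrecover 𝒵 f :=
  let ⟨_, hδ⟩ := h
  ⟨hB, fun V hV _ => hδ.exists_comp_eq_of_pull_eq_zero (eq_zero_of_leftOrth (h𝒵 V hV) hK _)⟩

lemma IsTriangle.isPreenvelope {Z M N : C} {g : Z ⟶ M} {q : M ⟶ N} (h : IsTriangle T g q)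
    (hM : 𝒳 M) (hN : leftOrth T 𝒳 N) : IsPreenvelope 𝒳 g :=
  let ⟨_, hδ⟩ := h
  ⟨hM, fun _ hV _ => hδ.exists_comp_eq_of_push_eq_zero (eq_zero_of_leftOrth hN hV _)⟩

end LeftOrth

/-! ### Coresolutions and approximations -/

lemma ClosedUnderExt.isClosedUnderIsomorphisms (hX : ClosedUnderExt T 𝒳) [𝒳.ContainsZero] :
    𝒳.IsClosedUnderIsomorphisms where
  of_iso e hA :=
    let ⟨_, hO, hXO⟩ := 𝒳.exists_prop_of_containsZero
    hX e.hom 0 ⟨0, realizes_of_isZero_right e hO⟩ hA hXO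

lemma HasCores.mono {𝒳' 𝒴' : ObjectProperty C} (hX : 𝒳 ≤ 𝒳') (hY : 𝒴 ≤ 𝒴') :
    ∀ {n : ℕ} {M : C}, HasCores T 𝒳 𝒴 n M → HasCores T 𝒳' 𝒴' n M
  | 0, M, hM => ObjectProperty.monotone_isoClosure (inf_le_inf hX hY) M hM
  | _ + 1, _, ⟨Y, N, x, y, h, hY', hN, hc⟩ =>
    ⟨Y, N, x, y, h, hY _ hY', hX _ hN, hc.mono hX hY⟩

lemma coresClass_mono {𝒳' 𝒴' : ObjectProperty C} (hX : 𝒳 ≤ 𝒳') (hY : 𝒴 ≤ 𝒴') :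
    coresClass T 𝒳 𝒴 ≤ coresClass T 𝒳' 𝒴' :=
  fun _ ⟨n, hM⟩ => ⟨n, hM.mono hX hY⟩

lemma HasCores.of_prop {M : C} (hX : 𝒳 M) (hY : 𝒴 M) : HasCores T 𝒳 𝒴 0 M :=
  ObjectProperty.le_isoClosure _ M ⟨hX, hY⟩

/-- As `𝒴` need not contain a zero object, a zero object need not have a coresolution of length
`0`. -/
lemma HasCores.of_isZero {Z W : C} (hZ : IsZero Z) (hX : 𝒳 W) (hY : 𝒴 W) : HasCores T 𝒳 𝒴 1 Z :=
  ⟨W, W, 0, 𝟙 W, ⟨0, realizes_of_isZero_left hZ (Iso.refl W)⟩, hY, hX, .of_prop hX hY⟩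

lemma coresdim_le {n : ℕ} {M : C} (h : HasCores T 𝒳 𝒴 n M) : coresdim T 𝒳 𝒴 M ≤ n :=
  sInf_le ⟨n, rfl, h⟩

lemma coresdim_eq_natCast_iff {n : ℕ} {M : C} :
    coresdim T 𝒳 𝒴 M = n ↔ IsLeast {k | HasCores T 𝒳 𝒴 k M} n := by
  constructor
  · intro h
    have hne : {m : ℕ∞ | ∃ k : ℕ, m = k ∧ HasCores T 𝒳 𝒴 k M}.Nonempty := by
      by_contra hne
      rw [coresdim, Set.not_nonempty_iff_eq_empty.1 hne, sInf_empty] at h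
      exact ENat.top_ne_natCast n h
    obtain ⟨k, hk, hM⟩ := csInf_mem hne
    obtain rfl : n = k := Nat.cast_inj.1 (h.symm.trans hk)
    exact ⟨hM, fun k hk => Nat.cast_le.1 (h.symm.le.trans (coresdim_le hk))⟩
  · rintro ⟨hM, hn⟩
    refine (coresdim_le hM).antisymm (le_sInf ?_)
    rintro _ ⟨k, rfl, hk⟩
    exact Nat.cast_le.2 (hn hk)

lemma IsRelGenerator.exists_triangle_succ (hω : IsRelGenerator T ω 𝒳) {Z M N : C} {g : Z ⟶ M}
    {q : M ⟶ N} (h : IsTriangle T g q) (hM : 𝒳 M) (hN : 𝒴 N) {n : ℕ} (hc : HasCores T 𝒴 ω n N) :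
    ∃ (K B : C) (i : K ⟶ B) (f : B ⟶ Z), IsTriangle T i f ∧ 𝒳 K ∧ HasCores T 𝒴 ω (n + 1) B := by
  obtain ⟨K, W, x, y, ⟨δ, hδ⟩, hK, hW⟩ := hω.2 M hM
  obtain ⟨δ', hδ'⟩ := h
  obtain ⟨B, i, f, b, ε, hε, -, -, hif, -, -⟩ := T.octahedron_op hδ hδ'
  exact ⟨K, B, i, f, ⟨_, hif⟩, hK, W, N, b, _, ⟨ε, hε⟩, hW, hN, hc⟩

lemma ClosedUnderExt.exists_triangle_of_fiberProduct (hX : ClosedUnderExt T 𝒳) {Z X N K B : C}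
    {x : Z ⟶ X} {y : X ⟶ N} {i : K ⟶ B} {f : B ⟶ N} (hxy : IsTriangle T x y)
    (hif : IsTriangle T i f) (hX' : 𝒳 X) (hK : 𝒳 K) :
    ∃ (M : C) (g : Z ⟶ M) (q : M ⟶ B), IsTriangle T g q ∧ 𝒳 M := by
  obtain ⟨δ, hδ⟩ := hxy
  obtain ⟨γ, hγ⟩ := hif
  obtain ⟨M, g, q, k, p, hgq, hkp, -⟩ := hδ.exists_fiberProduct hγ
  exact ⟨M, g, q, hgq, hX k p hkp hK hX'⟩

section Approximation

variable (hXY : 𝒳 ≤ 𝒴) (hX : ClosedUnderExt T 𝒳) (hω : IsRelGenerator T ω 𝒳) [𝒳.ContainsZero]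
include hXY hX hω

theorem exists_triangle_to_isZero {Z : C} (hZ : HasCores T 𝒴 𝒳 0 Z) :
    ∃ (M N : C) (g : Z ⟶ M) (q : M ⟶ N),
      IsTriangle T g q ∧ 𝒳 M ∧ pairClass T 𝒴 ω N ∧ IsZero N := by
  have := hX.isClosedUnderIsomorphisms
  obtain ⟨O, hO, hXO⟩ := 𝒳.exists_prop_of_containsZero
  obtain ⟨-, W, -, -, -, -, hW⟩ := hω.2 O hXO
  exact ⟨Z, O, 𝟙 Z, 0, ⟨0, realizes_of_isZero_right (Iso.refl Z) hO⟩,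
    (ObjectProperty.isoClosure_le_iff _ _).2 inf_le_right Z hZ,
    ⟨hXY _ hXO, 1, .of_isZero hO (hXY _ (hω.1 _ hW)) hW⟩, hO⟩

variable (hY : ClosedUnderExt T 𝒴)
include hY

theorem exists_triangle_from_hasCores {n : ℕ} {Z : C} (hZ : HasCores T 𝒴 𝒳 n Z) :
    ∃ (K B : C) (i : K ⟶ B) (f : B ⟶ Z), IsTriangle T i f ∧ 𝒳 K ∧ HasCores T 𝒴 ω n B := by
  induction n generalizing Z with
  | zero =>
    have := hX.isClosedUnderIsomorphisms
    obtain ⟨K, W, x, y, hxy, hK, hW⟩ :=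
      hω.2 Z ((ObjectProperty.isoClosure_le_iff _ _).2 inf_le_right Z hZ)
    exact ⟨K, W, x, y, hxy, hK, .of_prop (hXY _ (hω.1 _ hW)) hW⟩
  | succ n ih =>
    obtain ⟨X, N, x, y, hxy, hX', hN, hc⟩ := hZ
    obtain ⟨K, B, i, f, hif, hK, hB⟩ := ih hc
    obtain ⟨M, g, q, hgq, hM⟩ := hX.exists_triangle_of_fiberProduct hxy hif hX' hK
    exact hω.exists_triangle_succ hgq hM (hY i f hif (hXY _ hK) hN) hB

theorem exists_triangle_to_hasCores {n : ℕ} {Z : C} (hZ : HasCores T 𝒴 𝒳 (n + 1) Z) :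
    ∃ (M N : C) (g : Z ⟶ M) (q : M ⟶ N),
      IsTriangle T g q ∧ 𝒳 M ∧ 𝒴 N ∧ HasCores T 𝒴 ω n N := by
  obtain ⟨X, N, x, y, hxy, hX', hN, hc⟩ := hZ
  obtain ⟨K, B, i, f, hif, hK, hB⟩ := exists_triangle_from_hasCores hXY hX hω hY hc
  obtain ⟨M, g, q, hgq, hM⟩ := hX.exists_triangle_of_fiberProduct hxy hif hX' hK
  exact ⟨M, B, g, q, hgq, hM, hY i f hif (hXY _ hK) hN, hB⟩

theorem exists_triangle_to_coresdim_eq {n : ℕ} {Z : C} (hZ : coresdim T 𝒴 𝒳 Z = (n + 1 : ℕ)) :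
    ∃ (M N : C) (g : Z ⟶ M) (q : M ⟶ N),
      IsTriangle T g q ∧ 𝒳 M ∧ pairClass T 𝒴 ω N ∧ coresdim T 𝒴 ω N = n := by
  obtain ⟨hZn, hmin⟩ := coresdim_eq_natCast_iff.1 hZ
  obtain ⟨M, N, g, q, hgq, hM, hN, hc⟩ := exists_triangle_to_hasCores hXY hX hω hY hZn
  refine ⟨M, N, g, q, hgq, hM, ⟨hN, n, hc⟩, coresdim_eq_natCast_iff.2 ⟨hc, fun k hk => ?_⟩⟩
  exact Nat.le_of_succ_le_succ (hmin ⟨M, N, g, q, hgq, hM, hN, hk.mono le_rfl hω.1⟩)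

end Approximation

end Extri

theorem theorem3p3 {R : Type r} [CommRing R] {C : Type u} [Category.{v} C] [Preadditive C]
    [Linear R C] [HasZeroObject C] [HasBinaryBiproducts C]
    (T : Extri.Extriangulated.{w} R C) (𝒳 𝒴 ω : ObjectProperty C) (hXY : 𝒳 ≤ 𝒴)
    (hX : Extri.ClosedUnderExt T 𝒳) (hY : Extri.ClosedUnderExt T 𝒴)
    (hω : Extri.IsRelGenerator T ω 𝒳) (h0 : 𝒳.ContainsZero) :
    -- (1)
    (∀ (Z : C) (n : ℕ), Extri.coresdim T 𝒴 𝒳 Z = n →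
      (∃ (M_Z C_Z : C) (g : Z ⟶ M_Z) (q : M_Z ⟶ C_Z), Extri.IsTriangle T g q ∧
        𝒳 M_Z ∧ Extri.pairClass T 𝒴 ω C_Z ∧
        (1 ≤ n → Extri.coresdim T 𝒴 ω C_Z = ((n - 1 : ℕ) : ℕ∞)) ∧ (n = 0 → IsZero C_Z)) ∧
      (∃ (K_Z B_Z : C) (i : K_Z ⟶ B_Z) (f : B_Z ⟶ Z), Extri.IsTriangle T i f ∧
        𝒳 K_Z ∧ Extri.coresClass T 𝒴 ω B_Z ∧ Extri.coresdim T 𝒴 ω B_Z ≤ n)) ∧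
    -- (2)
    (∀ (Z K_Z B_Z : C) (i : K_Z ⟶ B_Z) (f : B_Z ⟶ Z), Extri.IsTriangle T i f →
      𝒳 K_Z → Extri.coresClass T 𝒴 ω B_Z →
      Extri.pairClass T 𝒴 𝒳 Z → Extri.pairClass T 𝒴 ω B_Z) ∧
    -- (3)
    (ω ≤ Extri.leftOrth T 𝒳 →
      Extri.coresClass T ⊤ ω ≤ Extri.leftOrth T 𝒳 ∧
      (∀ (Z K_Z B_Z : C) (i : K_Z ⟶ B_Z) (f : B_Z ⟶ Z), Extri.IsTriangle T i f →
        𝒳 K_Z → Extri.coresClass T 𝒴 ω B_Z →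
        Extri.IsPrecover (Extri.coresClass T ⊤ ω) f) ∧
      (∀ (Z M_Z C_Z : C) (g : Z ⟶ M_Z) (q : M_Z ⟶ C_Z), Extri.IsTriangle T g q →
        𝒳 M_Z → Extri.pairClass T 𝒴 ω C_Z →
        Extri.IsPreenvelope 𝒳 g)) := by
  refine ⟨fun Z n hn => ⟨?_, ?_⟩,
    fun Z K B i f hif hK hB hZ => ⟨hY i f hif (hXY K hK) hZ.1, hB⟩, fun hort =>
    ⟨Extri.coresClass_le_leftOrth hort,
      fun Z K B i f hif hK hB => hif.isPrecover (Extri.coresClass_le_leftOrth hort) hK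
        (Extri.coresClass_mono le_top le_rfl B hB),
      fun Z M N g q hgq hM hN =>
        hgq.isPreenvelope hM (Extri.coresClass_le_leftOrth hort N hN.2)⟩⟩
  · cases n with
    | zero =>
      obtain ⟨M, N, g, q, hgq, hM, hN, hN0⟩ :=
        Extri.exists_triangle_to_isZero hXY hX hω (Extri.coresdim_eq_natCast_iff.1 hn).1
      exact ⟨M, N, g, q, hgq, hM, hN, by simp, fun _ => hN0⟩
    | succ n =>
      obtain ⟨M, N, g, q, hgq, hM, hN, hdim⟩ :=
        Extri.exists_triangle_to_coresdim_eq hXY hX hω hY hn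
      exact ⟨M, N, g, q, hgq, hM, hN, fun _ => hdim, by simp⟩
  · obtain ⟨K, B, i, f, hif, hK, hB⟩ := Extri.exists_triangle_from_hasCores hXY hX hω hY
      (Extri.coresdim_eq_natCast_iff.1 hn).1
    exact ⟨K, B, i, f, hif, hK, ⟨n, hB⟩, Extri.coresdim_le hB⟩
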